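/- Let $(X,d)$ be a compact metric space and $v$ a continuous flow on $X$, written $(x,t)\mapsto x\cdot t$, $t\in\mathbb R$. **Cocycles.** A *continuous 1-cocycle* is a bounded function $\alpha:X\times X\to\mathbb R$ such that every point of the diagonal has a neighbourhood on which $\alpha$ is continuous, and every $x\in X$ has a neighbourhood $U$ with $\alpha(b,c)-\alpha(a,c)+\alpha(a,b)=0$ for all $a,b,c\in U$. For an open set $W\subset X$ and a continuous $\beta:W\to\mathbb R$ we say $\alpha=\delta\beta$ on $W$ if every $x\in W$ has a neighbourhood $U$ with $\alpha(a,b)=\beta(b)-\beta(a)$ for $a,b\in U$; $\alpha$ is *trivial* if $\alpha=\delta\beta$ on $X$ for some continuous $\beta$, and *nontrivial* otherwise. The integral $\int_\gamma\alpha$ along a continuous curve $\gamma:[a,b]\to X$ is the common value of $\sum_i\alpha(\gamma(t_i),\gamma(t_{i+1}))$ over all sufficiently fine partitions $a=t_0\le t_1\le\dots\le t_n=b$. The integral along a complete orbit $x\cdot\mathbb R$ is $\lim\int_{[x\cdot a,\,x\cdot b]}\alpha$ as $a\to-\infty$, $b\to+\infty$, if this limit exists. **$\alpha$-flows.** For a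 fixed point $p$, a compact isolating neighbourhood $V$ of $\{p\}$ (i.e. $p\in\operatorname{int}V$, and $p$ is the only point whose complete orbit lies in $V$), and $r>0$ with $\bar B_r(p)\subset V$, the *flow neighbourhood* $p(V,r)$ is the set of points of $V$ which reach $\bar B_r(p)$ in forward or backward time along an orbit arc contained in $V$. The flow $v$ is an *$\alpha$-flow*, $\alpha$ a continuous 1-cocycle, if its fixed points are finitely many points $p_1,\dots,p_n$ ($n\ge0$) and there are compact isolating neighbourhoods $V_i$ of $\{p_i\}$, $r>0$ with $\bar B_r(p_i)\subset V_i$ for all $i$, $T_0>0$, $\rho>0$ and $0\le\lambda<1$ such that, with $N_i=p_i(V_i,r)$ and $N=\bigcup_iN_i$: 1. for each $i$ there are an open set $W_i\supset N_i$ and a continuous function $\beta_i:W_i\to\mathbb R$ with $\alpha=\delta\beta_i$ on $W_i$ and $|\beta_i(y)-\beta_i(x)|\le\lambda\rho$ for all $x,y\in N_i$; 2. $\int_\gamma\alpha\ge\rho$ for every maximal trajectory $\gamma$ in $X\setminus N$ whose time domain is a bounded interval; 3. $\int_{\gamma'}\alpha\ge\rho$ for every piece $\gamma'$ of time length $T_0$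 of a maximal trajectory in $X\setminus N$ whose time domain is unbounded. **Gradient-like flows.** $v$ is *gradient-like* if there is a continuous function $g:X\to\mathbb R$ which is strictly decreasing along every nonconstant orbit. **Chains.** Let $\mathcal U(s)$ denote a covering of $X$ by balls of radius $s$. A *$(\mathcal U(s),T)$-chain* is a sequence $\tilde\gamma=\{x_1,\dots,x_{n+1}\mid t_1,\dots,t_n\}$, $n\ge1$, with $t_i\ge T$ and such that $x_i\cdot t_i$ and $x_{i+1}$ lie in a common ball of $\mathcal U(s)$ for $i=1,\dots,n$; its integral is $\int_{\tilde\gamma}\alpha=\sum_{i=1}^n\big(\int_{[x_i,\,x_i\cdot t_i]}\alpha+\alpha(x_i\cdot t_i,x_{i+1})\big)$. **Theorem.** Let $v$ be an $\alpha$-flow on the compact metric space $(X,d)$, with $\alpha$ nontrivial. Then $v$ is not gradient-like if at least one of the following holds. (a) There are a sequence $s_i>0$ with $s_i\to0$ and coverings $\mathcal U(s_i)$ of $X$ by balls of radius $s_i$ such that for all $M>0$ and $T>0$ and for every $i$ there is a $(\mathcal U(s_i),T)$-chain $\tilde\gamma_i$ with $\left|\int_{\tilde\gamma_i}\alpha\right|\ge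 M$. (b) For every $M>0$ there is an orbit arc $\tilde\gamma=[x,x\cdot t]$, $t\ge0$, with $\left|\int_{\tilde\gamma}\alpha\right|\ge M$. (c) There is an oriented cycle $\tilde\gamma_0$ of orbits joining fixed points, i.e. fixed points $q_0,q_1,\dots,q_k=q_0$ ($k\ge1$) and points $x_0,\dots,x_{k-1}$ such that $x_j\cdot t\to q_j$ as $t\to-\infty$ and $x_j\cdot t\to q_{j+1}$ as $t\to+\infty$, with $\left|\int_{\tilde\gamma_0}\alpha\right|=\Big|\sum_{j=0}^{k-1}\int_{x_j\cdot\mathbb R}\alpha\Big|\ge1$. -/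

import Mathlib

open Set Filter Topology

noncomputable section

/-! Alexander-Spanier 1-cochains on `X` are functions `α : X → X → ℝ`; two of them are identified
when they agree near the diagonal, so every condition on them is imposed near the diagonal only. -/

/-- A continuous 1-cocycle of bounded Alexander-Spanier cohomology: a bounded function on `X × X`
which, near the diagonal, is continuous and satisfies `δα = 0`. -/
structure IsContinuousCocycle {X : Type*} [TopologicalSpace X] (α : X → X → ℝ) : Prop where
  bounded : ∃ B : ℝ, ∀ x y : X, |α x y| ≤ B
  continuous_near : ∀ x : X, ∀ᶠ q : X × X in 𝓝 (x, x), ContinuousAt (Function.uncurry α) q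
  cocycle : ∀ x : X, ∀ᶠ q : X × X × X in 𝓝 (x, x, x),
    α q.2.1 q.2.2 - α q.1 q.2.2 + α q.1 q.2.1 = 0

/-- `α = δβ` as Alexander-Spanier cochains on the open set `W`, with `β` continuous on `W`. -/
def IsPrimitiveOn {X : Type*} [TopologicalSpace X] (α : X → X → ℝ) (β : X → ℝ) (W : Set X) :
    Prop :=
  ContinuousOn β W ∧ ∀ x ∈ W, ∀ᶠ q : X × X in 𝓝 (x, x), α q.1 q.2 = β q.2 - β q.1

/-- A trivial cocycle: a coboundary, that is, `[α] = 0`. -/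
def IsTrivialCocycle {X : Type*} [TopologicalSpace X] (α : X → X → ℝ) : Prop :=
  ∃ β : X → ℝ, IsPrimitiveOn α β univ

/-- `I` is the integral of `α` along the curve `γ` restricted to `[a, b]` (where `a ≤ b`): the sum
of `α` over the consecutive points of every sufficiently fine partition of `[a, b]` equals `I`. -/
def HasCocycleIntegral {X : Type*} (α : X → X → ℝ) (γ : ℝ → X) (a b I : ℝ) : Prop :=
  ∃ δ : ℝ, 0 < δ ∧ ∀ (n : ℕ) (t : ℕ → ℝ), Monotone t → t 0 = a → t n = b →
    (∀ i < n, t (i + 1) - t i < δ) → ∑ i ∈ Finset.range n, α (γ (t i)) (γ (t (i + 1))) = I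

open Classical in
/-- The integral of a cocycle `α` along `γ` restricted to `[a, b]`. By `exists_hasCocycleIntegral`
and `HasCocycleIntegral.eq` below it exists and is unique for a cocycle on a compact metric space, a
continuous curve, and `a ≤ b`. -/
def cocycleIntegral {X : Type*} (α : X → X → ℝ) (γ : ℝ → X) (a b : ℝ) : ℝ :=
  if h : ∃ I : ℝ, HasCocycleIntegral α γ a b I then h.choose else 0

theorem HasCocycleIntegral.unique {X : Type*} {α : X → X → ℝ} {γ : ℝ → X} {a b I J : ℝ}
    (hab : a ≤ b) (hI : HasCocycleIntegral α γ a b I) (hJ : HasCocycleIntegral α γ a b J) :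
    I = J := by
  obtain ⟨δ, hδ, h1⟩ := hI
  obtain ⟨ε, hε, h2⟩ := hJ
  obtain ⟨n, hn⟩ := exists_nat_gt ((b - a) / min δ ε)
  have hm : 0 < min δ ε := lt_min hδ hε
  have hn0 : (0 : ℝ) < n := lt_of_le_of_lt (div_nonneg (by linarith) hm.le) hn
  have hmesh : (b - a) / n < min δ ε := by
    rw [div_lt_iff₀ hm] at hn
    rw [div_lt_iff₀ hn0]; linarith
  have hstep : ∀ i : ℕ, (a + ((i + 1 : ℕ) : ℝ) * ((b - a) / n)) - (a + (i : ℝ) * ((b - a) / n))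
      = (b - a) / n := by intro i; push_cast; ring
  have hmono : Monotone (fun i : ℕ => a + (i : ℝ) * ((b - a) / n)) := by
    refine monotone_nat_of_le_succ fun i => ?_
    have := hstep i
    have h0 : 0 ≤ (b - a) / n := div_nonneg (by linarith) hn0.le
    linarith
  have he : a + (n : ℝ) * ((b - a) / n) = b := by field_simp; ring
  rw [← h1 n _ hmono (by simp) he fun i _ => by
        rw [hstep]; exact lt_of_lt_of_le hmesh (min_le_left _ _),
    ← h2 n _ hmono (by simp) he fun i _ => by
        rw [hstep]; exact lt_of_lt_of_le hmesh (min_le_right _ _)]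

theorem HasCocycleIntegral.eq {X : Type*} {α : X → X → ℝ} {γ : ℝ → X} {a b I : ℝ}
    (hab : a ≤ b) (hI : HasCocycleIntegral α γ a b I) : cocycleIntegral α γ a b = I := by
  have h : ∃ I : ℝ, HasCocycleIntegral α γ a b I := ⟨I, hI⟩
  rw [cocycleIntegral, dif_pos h]
  exact h.choose_spec.unique hab hI

theorem exists_hasCocycleIntegral {X : Type*} [MetricSpace X] [CompactSpace X] {α : X → X → ℝ}
    (hα : IsContinuousCocycle α) {γ : ℝ → X} (hγ : Continuous γ) {a b : ℝ} (hab : a ≤ b) :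
    ∃ I : ℝ, HasCocycleIntegral α γ a b I := by
  have huc : UniformContinuousOn γ (Icc a b) :=
    isCompact_Icc.uniformContinuousOn_of_continuous hγ.continuousOn
  obtain ⟨ε, hε, hco⟩ : ∃ ε > 0, ∀ x y z : X, dist y x < ε → dist z x < ε →
      α y z - α x z + α x y = 0 := by
    have h : ∀ x : X, ∃ U : Set X, IsOpen U ∧ x ∈ U ∧ ∀ p ∈ U, ∀ q ∈ U, ∀ r ∈ U,
        α q r - α p r + α p q = 0 := by
      intro x
      have := hα.cocycle x
      rw [nhds_prod_eq, nhds_prod_eq] at this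
      obtain ⟨u, hu, w, hw, h⟩ := Filter.mem_prod_iff.1 this
      obtain ⟨u2, hu2, u3, hu3, h'⟩ := Filter.mem_prod_iff.1 hw
      obtain ⟨U, hU, hUo, hxU⟩ := mem_nhds_iff.1 (inter_mem hu (inter_mem hu2 hu3))
      exact ⟨U, hUo, hxU, fun p hp q hq r hr =>
        h (show ((p, q, r) : X × X × X) ∈ u ×ˢ w from
          ⟨(hU hp).1, h' ⟨(hU hq).2.1, (hU hr).2.2⟩⟩)⟩
    choose U hUo hxU hU using h
    obtain ⟨ε, hε, hL⟩ := lebesgue_number_lemma_of_metric (isCompact_univ (X := X)) hUo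
      (fun x _ => mem_iUnion.2 ⟨x, hxU x⟩)
    refine ⟨ε, hε, fun x y z hy hz => ?_⟩
    obtain ⟨i, hi⟩ := hL x (mem_univ x)
    exact hU i x (hi (Metric.mem_ball_self hε)) y (hi hy) z (hi hz)
  obtain ⟨δ, hδ, hγδ⟩ := Metric.uniformContinuousOn_iff.1 huc ε hε
  have hco' : ∀ s ∈ Icc a b, ∀ t ∈ Icc a b, ∀ u ∈ Icc a b, |t - s| < δ → |u - s| < δ →
      α (γ t) (γ u) - α (γ s) (γ u) + α (γ s) (γ t) = 0 := fun s hs t ht u hu h1 h2 =>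
    hco _ _ _ (hγδ t ht s hs (by rwa [Real.dist_eq])) (hγδ u hu s hs (by rwa [Real.dist_eq]))
  have hdiag : ∀ x, α x x = 0 := fun x => by
    have := hco x x x (by simpa using hε) (by simpa using hε)
    linarith
  obtain ⟨N, hN⟩ := exists_nat_gt ((b - a) / (δ / 2))
  have hN0 : (0 : ℝ) < N := lt_of_le_of_lt (div_nonneg (by linarith) (by linarith)) hN
  set m : ℝ := (b - a) / N with hm
  have hm0 : 0 ≤ m := div_nonneg (by linarith) hN0.le
  have hmesh : m < δ / 2 := by
    rw [div_lt_iff₀ (by linarith)] at hN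
    rw [hm, div_lt_iff₀ hN0]; linarith
  have hNm : (N : ℝ) * m = b - a := by rw [hm]; field_simp
  let τ : ℕ → ℝ := fun i => a + i * m
  have hτs : ∀ i, τ (i + 1) = τ i + m := fun i => by simp only [τ]; push_cast; ring
  have hτ0 : τ 0 = a := by simp [τ]
  have hτN : τ N = b := by simp only [τ]; linarith
  have hτa : ∀ i, a ≤ τ i := fun i => by
    have : (0 : ℝ) ≤ i * m := by positivity
    simp only [τ]; linarith
  let F : ℝ → ℝ := fun t => ∑ i ∈ Finset.range N, α (γ (min t (τ i))) (γ (min t (τ (i + 1))))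
  have hF : ∀ s ∈ Icc a b, ∀ t ∈ Icc a b, s ≤ t → t - s < δ / 2 →
      α (γ s) (γ t) = F t - F s := by
    intro s hs t ht hst hd
    have hmem : ∀ u ∈ Icc a b, ∀ i, min u (τ i) ∈ Icc a b := fun u hu i =>
      ⟨le_min hu.1 (hτa i), (min_le_left _ _).trans hu.2⟩
    have key : ∀ i, α (γ (min t (τ i))) (γ (min t (τ (i + 1))))
        - α (γ (min s (τ i))) (γ (min s (τ (i + 1))))
        = α (γ (min s (τ (i + 1)))) (γ (min t (τ (i + 1))))
          - α (γ (min s (τ i))) (γ (min t (τ i))) := by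
      intro i
      have b1 : |min t (τ i) - min s (τ i)| < δ := by
        rw [abs_lt]; constructor <;> grind
      have b2 : |min t (τ (i + 1)) - min s (τ i)| < δ := by
        rw [hτs, abs_lt]; constructor <;> grind
      have b3 : |min s (τ (i + 1)) - min s (τ i)| < δ := by
        rw [hτs, abs_lt]; constructor <;> grind
      have e1 := hco' _ (hmem s hs i) _ (hmem t ht i) _ (hmem t ht (i + 1)) b1 b2
      have e2 := hco' _ (hmem s hs i) _ (hmem s hs (i + 1)) _ (hmem t ht (i + 1)) b3 b2
      linarith
    have : F t - F s = α (γ (min s (τ N))) (γ (min t (τ N)))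
        - α (γ (min s (τ 0))) (γ (min t (τ 0))) := by
      simp only [F]
      rw [← Finset.sum_sub_distrib, Finset.sum_congr rfl fun i _ => key i]
      exact Finset.sum_range_sub (fun i => α (γ (min s (τ i))) (γ (min t (τ i)))) N
    rw [this, hτN, hτ0, min_eq_left hs.2, min_eq_left ht.2, min_eq_right hs.1,
      min_eq_right ht.1, hdiag, sub_zero]
  refine ⟨F b - F a, δ / 2, by linarith, fun n t ht h0 hn hmesh' => ?_⟩
  have hin : ∀ i ≤ n, t i ∈ Icc a b := fun i hi =>
    ⟨h0 ▸ ht (Nat.zero_le i), hn ▸ ht hi⟩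
  have : ∀ i ∈ Finset.range n, α (γ (t i)) (γ (t (i + 1))) = F (t (i + 1)) - F (t i) := by
    intro i hi
    have hi := Finset.mem_range.1 hi
    exact hF _ (hin i hi.le) _ (hin (i + 1) hi) (ht (Nat.le_succ i)) (hmesh' i hi)
  rw [Finset.sum_congr rfl this, Finset.sum_range_sub (fun i => F (t i)) n, h0, hn]

/-- The integral of `α` along the orbit arc `[x·a, x·b]`, `a ≤ b`. -/
def orbitIntegral {X : Type*} [TopologicalSpace X] (v : Flow ℝ X) (α : X → X → ℝ) (x : X)
    (a b : ℝ) : ℝ :=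
  cocycleIntegral α (fun t => v t x) a b

/-- `p` is a fixed (rest) point of the flow. -/
def IsRestPoint {X : Type*} [TopologicalSpace X] (v : Flow ℝ X) (p : X) : Prop :=
  ∀ t : ℝ, v t p = p

/-- `V` is a (compact) isolating neighbourhood of `A`: `A` lies in the interior of `V` and is the
largest invariant subset of `V`. -/
def IsIsolatingNhd {X : Type*} [TopologicalSpace X] (v : Flow ℝ X) (A V : Set X) : Prop :=
  IsCompact V ∧ A ⊆ interior V ∧ {x : X | ∀ t : ℝ, v t x ∈ V} = A

/-- The flow neighbourhood `A(V, r)` of the point `p`: the points of `V` that reach the closed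
`r`-ball about `p` in forward or in backward time along an orbit arc contained in `V`. -/
def flowNhd {X : Type*} [MetricSpace X] (v : Flow ℝ X) (p : X) (V : Set X) (r : ℝ) : Set X :=
  {x : X | (∃ t : ℝ, 0 ≤ t ∧ (∀ u ∈ Icc 0 t, v u x ∈ V) ∧ v t x ∈ Metric.closedBall p r) ∨
    (∃ t : ℝ, t ≤ 0 ∧ (∀ u ∈ Icc t 0, v u x ∈ V) ∧ v t x ∈ Metric.closedBall p r)}

/-- The flow `v` is an `α`-flow: it is a flow carrying the continuous cocycle `α` with respect to
an isolated invariant set `A` that contains all fixed points and consists of finitely many points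
(possibly none). With `N` the union of the flow neighbourhoods of the points of `A`:
`small` bounds the variation of a primitive of `α` on each of the flow neighbourhoods;
`crossing` concerns the maximal trajectories in the complement of `N` with bounded time domain
(moved to `(0, b)`; their two end points lie in `N`);
`long` concerns the pieces `[x, x·T₀]` of the trajectories in the complement of `N` whose time
domain is unbounded above or below. -/
structure AlphaFlowData {X : Type*} [MetricSpace X] (v : Flow ℝ X) (α : X → X → ℝ)
    (A : Finset X) (V : X → Set X) (r T₀ ρ lam : ℝ) : Prop where
  rest_mem : ∀ p : X, IsRestPoint v p → p ∈ A
  isolating : ∀ p ∈ A, IsIsolatingNhd v {p} (V p)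
  r_pos : 0 < r
  ball_subset : ∀ p ∈ A, Metric.closedBall p r ⊆ V p
  T₀_pos : 0 < T₀
  ρ_pos : 0 < ρ
  lam_nonneg : 0 ≤ lam
  lam_lt_one : lam < 1
  small : ∀ p ∈ A, ∃ (W : Set X) (β : X → ℝ), IsOpen W ∧ flowNhd v p (V p) r ⊆ W ∧
    IsPrimitiveOn α β W ∧
    ∀ x ∈ flowNhd v p (V p) r, ∀ y ∈ flowNhd v p (V p) r, |β y - β x| ≤ lam * ρ
  crossing : ∀ (x : X) (b : ℝ), 0 < b →
    x ∈ (⋃ p ∈ A, flowNhd v p (V p) r) → v b x ∈ (⋃ p ∈ A, flowNhd v p (V p) r) →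
    (∀ t ∈ Ioo 0 b, v t x ∉ ⋃ p ∈ A, flowNhd v p (V p) r) →
    ρ ≤ orbitIntegral v α x 0 b
  long : ∀ x : X,
    ((∀ t : ℝ, 0 ≤ t → v t x ∉ ⋃ p ∈ A, flowNhd v p (V p) r) ∨
      (∀ t : ℝ, t ≤ T₀ → v t x ∉ ⋃ p ∈ A, flowNhd v p (V p) r)) →
    ρ ≤ orbitIntegral v α x 0 T₀

/-- `v` is an `α`-flow, for the continuous 1-cocycle `α`. -/
def IsAlphaFlow {X : Type*} [MetricSpace X] (v : Flow ℝ X) (α : X → X → ℝ) : Prop :=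
  IsContinuousCocycle α ∧
    ∃ (A : Finset X) (V : X → Set X) (r T₀ ρ lam : ℝ), AlphaFlowData v α A V r T₀ ρ lam

/-- `v` is gradient-like: some continuous function (a Lyapunov function) is strictly decreasing
along every nonconstant orbit. -/
def IsGradientLike {X : Type*} [TopologicalSpace X] (v : Flow ℝ X) : Prop :=
  ∃ g : X → ℝ, Continuous g ∧
    ∀ x : X, ¬ IsRestPoint v x → StrictAnti (fun t : ℝ => g (v t x))

/-- The balls of radius `s` with centres in `C` form a covering of `X`. -/
def IsBallCovering {X : Type*} [MetricSpace X] (C : Set X) (s : ℝ) : Prop :=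
  (⋃ c ∈ C, Metric.ball c s) = univ

/-- The points `x 0, …, x n` and the times `t 0, …, t (n - 1)` form a `(𝒰, T)`-chain, for the
covering `𝒰` of `X` by the balls of radius `s` with centres in `C`. -/
def IsFlowChain {X : Type*} [MetricSpace X] (v : Flow ℝ X) (C : Set X) (s T : ℝ) {n : ℕ}
    (x : Fin (n + 1) → X) (t : Fin n → ℝ) : Prop :=
  0 < n ∧ ∀ i : Fin n, T ≤ t i ∧
    ∃ c ∈ C, v (t i) (x i.castSucc) ∈ Metric.ball c s ∧ x i.succ ∈ Metric.ball c s

/-- The integral of `α` along a chain: the orbit arcs and the jumps both contribute. -/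
def chainIntegral {X : Type*} [TopologicalSpace X] (v : Flow ℝ X) (α : X → X → ℝ) {n : ℕ}
    (x : Fin (n + 1) → X) (t : Fin n → ℝ) : ℝ :=
  ∑ i : Fin n,
    (orbitIntegral v α (x i.castSucc) 0 (t i) + α (v (t i) (x i.castSucc)) (x i.succ))

/-- An oriented cycle of orbits: fixed points `p 0, …, p k = p 0` and, for each `j < k`, the orbit
of `x j`, which runs from `p j` (as `t → -∞`) to `p (j + 1)` (as `t → +∞`). -/
def IsOrbitCycle {X : Type*} [TopologicalSpace X] (v : Flow ℝ X) {k : ℕ}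
    (p : Fin (k + 1) → X) (x : Fin k → X) : Prop :=
  0 < k ∧ p (Fin.last k) = p 0 ∧ (∀ j, IsRestPoint v (p j)) ∧
    ∀ j : Fin k, Tendsto (fun t : ℝ => v t (x j)) atBot (𝓝 (p j.castSucc)) ∧
      Tendsto (fun t : ℝ => v t (x j)) atTop (𝓝 (p j.succ))

/-- `I` is the integral of `α` along the complete orbit of `x`, in its forward direction. -/
def HasFullOrbitIntegral {X : Type*} [TopologicalSpace X] (v : Flow ℝ X) (α : X → X → ℝ) (x : X)
    (I : ℝ) : Prop :=
  Tendsto (fun q : ℝ × ℝ => orbitIntegral v α x q.1 q.2) (atBot ×ˢ atTop) (𝓝 I)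

end

/-! Given a Lyapunov function `g`, each of the three conditions fails. Small disjoint closed balls
about the finitely many points of `A` carry bounded primitives of `α`
(`AlphaFlowData.exists_hasBallPrimitives`), and away from these points the flow lowers `g` by a
definite amount in a fixed time (`IsLyapunov.exists_drop`). As `g` has finite oscillation, an orbit
arc makes boundedly many excursions out of the balls; inside a ball its integral is a difference of
two values of the primitive. So integrals along arcs are uniformly bounded, which excludes (b).

For a chain with long times, every arc passes close to a point of `A`. If consecutive passages are
near `p` and then `q`, either `g q < g p`, which can happen fewer than `A.card` times, or `g p ≤ g
q`. In the latter case a small jump cannot make up for the loss of `g` on leaving the ball about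
`p`, so `p = q` and the primitive computes the whole piece (`IsLyapunov.exists_level_passage`). Such
pieces telescope, so the bound does not depend on the length of the chain; this excludes (a).

Around a cycle of orbits `g` cannot increase and returns to its initial value, so every orbit in it
is constant and contributes zero; this excludes (c). -/

/-! ### Uniformity near the diagonal and integrals along curves -/

/-- A property that holds near the diagonal points of a compact set holds uniformly near it. -/
theorem IsCompact.exists_uniform_near_diagonal {X : Type*} [MetricSpace X] {K : Set X}
    (hK : IsCompact K) {P : X → X → Prop}
    (h : ∀ x ∈ K, ∀ᶠ q : X × X in 𝓝 (x, x), P q.1 q.2) :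
    ∃ ε > 0, ∀ x ∈ K, ∀ y, dist x y < ε → P x y := by
  have h' : ∀ x : K, ∃ U : Set X, IsOpen U ∧ (x : X) ∈ U ∧ ∀ a ∈ U, ∀ b ∈ U, P a b := by
    intro x
    have := h x x.2
    rw [nhds_prod_eq] at this
    obtain ⟨u, hu, w, hw, h⟩ := Filter.mem_prod_iff.1 this
    obtain ⟨U, hU, hUo, hxU⟩ := mem_nhds_iff.1 (inter_mem hu hw)
    exact ⟨U, hUo, hxU, fun a ha b hb => h (show (a, b) ∈ u ×ˢ w from ⟨(hU ha).1, (hU hb).2⟩)⟩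
  choose U hUo hxU hU using h'
  obtain ⟨ε, hε, hL⟩ := lebesgue_number_lemma_of_metric hK hUo
    (fun x hx => mem_iUnion.2 ⟨⟨x, hx⟩, hxU ⟨x, hx⟩⟩)
  refine ⟨ε, hε, fun x hx y hy => ?_⟩
  obtain ⟨i, hi⟩ := hL x hx
  exact hU i x (hi (Metric.mem_ball_self hε)) y (hi (by rwa [Metric.mem_ball, dist_comm]))

/-- A Lebesgue number argument. The uniform identity makes `α x` a primitive of `α` on the `ε`-ball
about `x`, and gives `α x x = 0`. -/
theorem IsContinuousCocycle.exists_uniform_cocycle {X : Type*} [MetricSpace X] [CompactSpace X]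
    {α : X → X → ℝ} (hα : IsContinuousCocycle α) :
    ∃ ε > 0, ∀ x y z : X, dist y x < ε → dist z x < ε → α y z - α x z + α x y = 0 := by
  have h : ∀ x : X, ∃ U : Set X, IsOpen U ∧ x ∈ U ∧ ∀ p ∈ U, ∀ q ∈ U, ∀ r ∈ U,
      α q r - α p r + α p q = 0 := by
    intro x
    have := hα.cocycle x
    rw [nhds_prod_eq, nhds_prod_eq] at this
    obtain ⟨u, hu, w, hw, h⟩ := Filter.mem_prod_iff.1 this
    obtain ⟨u2, hu2, u3, hu3, h'⟩ := Filter.mem_prod_iff.1 hw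
    obtain ⟨U, hU, hUo, hxU⟩ := mem_nhds_iff.1 (inter_mem hu (inter_mem hu2 hu3))
    exact ⟨U, hUo, hxU, fun p hp q hq r hr =>
      h (show ((p, q, r) : X × X × X) ∈ u ×ˢ w from
        ⟨(hU hp).1, h' ⟨(hU hq).2.1, (hU hr).2.2⟩⟩)⟩
  choose U hUo hxU hU using h
  obtain ⟨ε, hε, hL⟩ := lebesgue_number_lemma_of_metric (isCompact_univ (X := X)) hUo
    (fun x _ => mem_iUnion.2 ⟨x, hxU x⟩)
  refine ⟨ε, hε, fun x y z hy hz => ?_⟩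
  obtain ⟨i, hi⟩ := hL x (mem_univ x)
  exact hU i x (hi (Metric.mem_ball_self hε)) y (hi hy) z (hi hz)

/-- A primitive of `α` along a curve computes the integral. -/
theorem hasCocycleIntegral_of_primitive {X : Type*} {α : X → X → ℝ} {γ : ℝ → X} {a b δ : ℝ}
    (hδ : 0 < δ) {F : ℝ → ℝ}
    (hF : ∀ s ∈ Icc a b, ∀ t ∈ Icc a b, s ≤ t → t - s < δ → α (γ s) (γ t) = F t - F s) :
    HasCocycleIntegral α γ a b (F b - F a) := by
  refine ⟨δ, hδ, fun n t ht h0 hn hmesh => ?_⟩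
  have hin : ∀ i ≤ n, t i ∈ Icc a b := fun i hi => ⟨h0 ▸ ht (Nat.zero_le i), hn ▸ ht hi⟩
  have : ∀ i ∈ Finset.range n, α (γ (t i)) (γ (t (i + 1))) = F (t (i + 1)) - F (t i) := by
    intro i hi
    have hi := Finset.mem_range.1 hi
    exact hF _ (hin i hi.le) _ (hin (i + 1) hi) (ht (Nat.le_succ i)) (hmesh i hi)
  rw [Finset.sum_congr rfl this, Finset.sum_range_sub (fun i => F (t i)) n, h0, hn]

theorem HasCocycleIntegral.add_adjacent {X : Type*} {α : X → X → ℝ} {γ : ℝ → X} {a b c I J S : ℝ}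
    (hab : a ≤ b) (hbc : b ≤ c) (hI : HasCocycleIntegral α γ a b I)
    (hJ : HasCocycleIntegral α γ b c J) (hS : HasCocycleIntegral α γ a c S) : S = I + J := by
  obtain ⟨δ₁, hδ₁, h1⟩ := hI
  obtain ⟨δ₂, hδ₂, h2⟩ := hJ
  obtain ⟨δ₃, hδ₃, h3⟩ := hS
  obtain ⟨δ, hδ, hd1, hd2, hd3⟩ : ∃ δ > 0, δ ≤ δ₁ ∧ δ ≤ δ₂ ∧ δ ≤ δ₃ :=
    ⟨min δ₁ (min δ₂ δ₃), by positivity, by simp, by simp, by simp⟩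
  obtain ⟨n, hn⟩ := exists_nat_gt ((c - a) / δ)
  have hn0 : (0 : ℝ) < n := lt_of_le_of_lt (div_nonneg (by linarith) hδ.le) hn
  rw [div_lt_iff₀ hδ] at hn
  set k₁ : ℝ := (b - a) / n with hk₁
  set k₂ : ℝ := (c - b) / n with hk₂
  have e1 : (n : ℝ) * k₁ = b - a := by rw [hk₁]; field_simp
  have e2 : (n : ℝ) * k₂ = c - b := by rw [hk₂]; field_simp
  have p1 : 0 ≤ k₁ := div_nonneg (by linarith) hn0.le
  have p2 : 0 ≤ k₂ := div_nonneg (by linarith) hn0.le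
  have l1 : k₁ < δ := by rw [hk₁, div_lt_iff₀ hn0]; linarith
  have l2 : k₂ < δ := by rw [hk₂, div_lt_iff₀ hn0]; linarith
  let t₁ : ℕ → ℝ := fun i => a + i * k₁
  let t₂ : ℕ → ℝ := fun i => b + i * k₂
  -- Concatenation of two fine partitions with `n` steps each; at the joint `i = n` both formulas
  -- give `b`.
  let t₃ : ℕ → ℝ := fun i => if i ≤ n then t₁ i else t₂ (i - n)
  have s1 : ∀ i, t₁ (i + 1) = t₁ i + k₁ := fun i => by simp only [t₁]; push_cast; ring
  have s2 : ∀ i, t₂ (i + 1) = t₂ i + k₂ := fun i => by simp only [t₂]; push_cast; ring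
  have hb1 : t₁ n = b := by simp only [t₁]; linarith
  have hb2 : t₂ 0 = b := by simp [t₂]
  have a1 : ∀ i ≤ n, t₃ i = t₁ i := fun i hi => by simp [t₃, hi]
  have a2 : ∀ j, t₃ (n + j) = t₂ j := by
    intro j
    rcases Nat.eq_zero_or_pos j with rfl | hj
    · rw [add_zero, a1 n le_rfl, hb1, hb2]
    · simp [t₃, hj.ne']
  have s3 : ∀ i, t₃ i ≤ t₃ (i + 1) ∧ t₃ (i + 1) - t₃ i < δ := by
    intro i
    rcases lt_or_ge i n with hi | hi
    · rw [a1 i hi.le, a1 (i + 1) hi, s1]; constructor <;> linarith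
    · obtain ⟨j, rfl⟩ := Nat.exists_eq_add_of_le hi
      rw [add_assoc, a2, a2, s2]; constructor <;> linarith
  rw [← h1 n t₁ (monotone_nat_of_le_succ fun i => by rw [s1]; linarith) (by simp [t₁]) hb1
      fun i _ => by rw [s1]; linarith,
    ← h2 n t₂ (monotone_nat_of_le_succ fun i => by rw [s2]; linarith) hb2
      (by simp only [t₂]; linarith) fun i _ => by rw [s2]; linarith,
    ← h3 (n + n) t₃ (monotone_nat_of_le_succ fun i => (s3 i).1)
      (by rw [a1 0 (Nat.zero_le n)]; simp [t₁]) (by rw [a2]; simp only [t₂]; linarith)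
      fun i _ => (s3 i).2.trans_le hd3, Finset.sum_range_add]
  congr 1
  · refine Finset.sum_congr rfl fun i hi => ?_
    have hi := Finset.mem_range.1 hi
    rw [a1 i hi.le, a1 (i + 1) hi]
  · exact Finset.sum_congr rfl fun i _ => by rw [add_assoc, a2, a2]

/-! ### Integrals along orbit arcs -/

section Flow

variable {X : Type*} [MetricSpace X]

theorem orbit_continuous (v : Flow ℝ X) (x : X) : Continuous fun t : ℝ => v t x :=
  v.continuous continuous_id continuous_const

theorem orbitIntegral_shift [CompactSpace X] {v : Flow ℝ X} {α : X → X → ℝ}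
    (hα : IsContinuousCocycle α) (x : X) (s : ℝ) {a b : ℝ} (hab : a ≤ b) :
    orbitIntegral v α (v s x) a b = orbitIntegral v α x (a + s) (b + s) := by
  obtain ⟨I, hI⟩ := exists_hasCocycleIntegral hα (orbit_continuous v x)
    (show a + s ≤ b + s by linarith)
  unfold orbitIntegral
  rw [hI.eq (by linarith)]
  refine HasCocycleIntegral.eq hab ?_
  obtain ⟨δ, hδ, h⟩ := hI
  refine ⟨δ, hδ, fun n t ht h0 hn hm => ?_⟩
  simp only [← v.map_add]
  exact h n (fun i => t i + s) (fun i j hij => by simpa using ht hij) (by simp [h0]) (by simp [hn])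
    fun i hi => by simpa using hm i hi

theorem orbitIntegral_split [CompactSpace X] {v : Flow ℝ X} {α : X → X → ℝ}
    (hα : IsContinuousCocycle α) (x : X) {s t : ℝ} (hs : 0 ≤ s) (hst : s ≤ t) :
    orbitIntegral v α x 0 t = orbitIntegral v α x 0 s + orbitIntegral v α (v s x) 0 (t - s) := by
  rw [orbitIntegral_shift hα x s (by linarith), zero_add, sub_add_cancel]
  obtain ⟨I, hI⟩ := exists_hasCocycleIntegral hα (orbit_continuous v x) hs
  obtain ⟨J, hJ⟩ := exists_hasCocycleIntegral hα (orbit_continuous v x) hst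
  obtain ⟨S, hS⟩ := exists_hasCocycleIntegral hα (orbit_continuous v x) (hs.trans hst)
  unfold orbitIntegral
  rw [hI.eq hs, hJ.eq hst, hS.eq (hs.trans hst)]
  exact hI.add_adjacent hs hst hJ hS

theorem exists_uniform_flow_near [CompactSpace X] (v : Flow ℝ X) {ε : ℝ} (hε : 0 < ε) :
    ∃ δ > 0, ∀ u, 0 ≤ u → u ≤ δ → ∀ x, dist (v u x) x < ε := by
  have h : ∀ᶠ u in 𝓝 (0 : ℝ), ∀ x ∈ (univ : Set X), dist (v u x) x < ε := by
    refine isCompact_univ.eventually_forall_of_forall_eventually fun x _ => ?_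
    have hc : Continuous fun z : ℝ × X => dist (v z.1 z.2) z.2 :=
      (v.continuous continuous_fst continuous_snd).dist continuous_snd
    exact hc.continuousAt.eventually_lt_const (by simpa using hε)
  obtain ⟨δ, hδ, h⟩ := Metric.eventually_nhds_iff.1 h
  refine ⟨δ / 2, by linarith, fun u h0 hu x => h ?_ x (mem_univ x)⟩
  rw [Real.dist_eq, abs_lt]; constructor <;> linarith

/-- Short orbit arcs have uniformly bounded integral. -/
theorem exists_short_orbitIntegral_bound [CompactSpace X] (v : Flow ℝ X) {α : X → X → ℝ}
    (hα : IsContinuousCocycle α) :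
    ∃ δ > 0, ∃ B, 0 ≤ B ∧ (∀ x y, |α x y| ≤ B) ∧
      ∀ x t, 0 ≤ t → t ≤ δ → |orbitIntegral v α x 0 t| ≤ B := by
  obtain ⟨B, hB⟩ := hα.bounded
  obtain ⟨ε, hε, hco⟩ := hα.exists_uniform_cocycle
  obtain ⟨δ, hδ, hv⟩ := exists_uniform_flow_near v hε
  refine ⟨δ, hδ, max B 0, le_max_right _ _, fun x y => (hB x y).trans (le_max_left _ _),
    fun x t h0 ht => ?_⟩
  have hd : α x x = 0 := by
    have := hco x x x (by simpa) (by simpa); linarith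
  -- The arc stays in the `ε`-ball about `x`, where `α x` is a primitive, so any mesh will do.
  have : orbitIntegral v α x 0 t = α x (v t x) - α x (v 0 x) := by
    refine HasCocycleIntegral.eq h0 (hasCocycleIntegral_of_primitive (F := fun u => α x (v u x))
      one_pos fun s hs u hu _ _ => ?_)
    have := hco x (v s x) (v u x) (hv s hs.1 (hs.2.trans ht) x) (hv u hu.1 (hu.2.trans ht) x)
    linarith
  rw [this, v.map_zero_apply, hd, sub_zero]
  exact (hB _ _).trans (le_max_left _ _)

/-! ### Primitives near the points of `A` -/

/-- Separated closed balls about the points of `A` on which `α` has bounded primitives. -/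
structure HasBallPrimitives (α : X → X → ℝ) (A : Finset X) (β : X → X → ℝ) (r ε L : ℝ) :
    Prop where
  r_pos : 0 < r
  ε_pos : 0 < ε
  sep : ∀ p ∈ A, ∀ q ∈ A, p ≠ q → 2 * r < dist p q
  prim : ∀ p ∈ A, ∀ x ∈ Metric.closedBall p r, ∀ y ∈ Metric.closedBall p r, dist x y < ε →
    α x y = β p y - β p x
  L_nonneg : 0 ≤ L
  bound : ∀ p ∈ A, ∀ x ∈ Metric.closedBall p r, |β p x| ≤ L

/-- The flow neighbourhood of `p` contains the closed `r`-ball (take time `0`), so the primitives in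
`small` restrict to it. Compactness of the balls gives a common `ε`, and finiteness of `A` lets the
radius shrink until the balls are separated. -/
theorem AlphaFlowData.exists_hasBallPrimitives [CompactSpace X] {v : Flow ℝ X} {α : X → X → ℝ}
    {A : Finset X} {V : X → Set X} {r T₀ ρ lam : ℝ} (h : AlphaFlowData v α A V r T₀ ρ lam) :
    ∃ (β : X → X → ℝ) (r' ε L : ℝ), HasBallPrimitives α A β r' ε L := by
  classical
  have hN : ∀ p ∈ A, Metric.closedBall p r ⊆ flowNhd v p (V p) r := by
    intro p hp x hx
    refine Or.inl ⟨0, le_rfl, fun u hu => ?_, by simpa using hx⟩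
    obtain rfl : u = 0 := le_antisymm hu.2 hu.1
    simpa using h.ball_subset p hp hx
  have hβ : ∀ p, ∃ β : X → ℝ, p ∈ A → (∀ x ∈ Metric.closedBall p r, |β x| ≤ lam * ρ) ∧
      ∃ ε > 0, ∀ x ∈ Metric.closedBall p r, ∀ y, dist x y < ε → α x y = β y - β x := by
    intro p
    by_cases hp : p ∈ A
    · obtain ⟨W, β, -, hNW, ⟨-, hprim⟩, hsm⟩ := h.small p hp
      -- Normalised to vanish at `p`, so that the bound on the variation becomes a bound on the
      -- values.
      refine ⟨fun x => β x - β p, fun _ => ⟨fun x hx => ?_, ?_⟩⟩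
      · exact hsm p (hN p hp (Metric.mem_closedBall_self h.r_pos.le)) x (hN p hp hx)
      · simp only [sub_sub_sub_cancel_right]
        exact Metric.isClosed_closedBall.isCompact.exists_uniform_near_diagonal
          fun x hx => hprim x (hNW (hN p hp hx))
    · exact ⟨0, fun hp' => absurd hp' hp⟩
  choose β hβ using hβ
  have e1 : ∀ᶠ ε in 𝓝[>] (0 : ℝ), ∀ p ∈ A, ∀ x ∈ Metric.closedBall p r, ∀ y, dist x y < ε →
      α x y = β p y - β p x := by
    refine (Finset.eventually_all A).2 fun p hp => ?_
    obtain ⟨ε, hε, he⟩ := (hβ p hp).2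
    filter_upwards [Ioo_mem_nhdsGT hε] with ε' hε' x hx y hy using he x hx y (hy.trans hε'.2)
  have e2 : ∀ᶠ s in 𝓝[>] (0 : ℝ), ∀ p ∈ A, ∀ q ∈ A, p ≠ q → 2 * s < dist p q := by
    refine (Finset.eventually_all A).2 fun p hp => (Finset.eventually_all A).2 fun q hq => ?_
    by_cases hpq : p = q
    · exact Eventually.of_forall fun _ h => absurd hpq h
    · filter_upwards [Ioo_mem_nhdsGT (half_pos (dist_pos.2 hpq))] with s hs _
      linarith [hs.2]
  obtain ⟨ε, he, hε⟩ := (e1.and self_mem_nhdsWithin).exists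
  obtain ⟨s, hs, hsr⟩ := (e2.and (Ioo_mem_nhdsGT h.r_pos)).exists
  have hsub : ∀ p : X, Metric.closedBall p s ⊆ Metric.closedBall p r := fun p =>
    Metric.closedBall_subset_closedBall hsr.2.le
  exact ⟨β, s, ε, lam * ρ, hsr.1, hε, hs, fun p hp x hx y _ => he p hp x (hsub p hx) y,
    mul_nonneg h.lam_nonneg h.ρ_pos.le, fun p hp x hx => (hβ p hp).1 x (hsub p hx)⟩

/-- The integral along an orbit arc in one of the balls. -/
theorem HasBallPrimitives.orbitIntegral_eq [CompactSpace X] {v : Flow ℝ X} {α : X → X → ℝ}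
    {A : Finset X} {β : X → X → ℝ} {r ε L : ℝ} (h : HasBallPrimitives α A β r ε L) {p : X}
    (hp : p ∈ A) {x : X} {t : ℝ} (ht : 0 ≤ t)
    (hx : ∀ u ∈ Icc 0 t, v u x ∈ Metric.closedBall p r) :
    orbitIntegral v α x 0 t = β p (v t x) - β p x := by
  -- With mesh `δ`, consecutive points of the arc are within `ε`.
  obtain ⟨δ, hδ, hv⟩ := exists_uniform_flow_near v h.ε_pos
  have := HasCocycleIntegral.eq ht (hasCocycleIntegral_of_primitive (α := α)
    (γ := fun u => v u x) (F := fun u => β p (v u x)) hδ fun s hs u hu hsu hd =>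
      h.prim p hp _ (hx s hs) _ (hx u hu) (by
        have := hv (u - s) (by linarith) hd.le (v s x)
        rwa [← v.map_add, sub_add_cancel, dist_comm] at this))
  simpa [orbitIntegral] using this

theorem exists_first_hit {f : ℝ → ℝ} (hf : Continuous f) {r t : ℝ} (ht : 0 ≤ t) (h0 : f 0 ≤ r)
    (h1 : r ≤ f t) : ∃ s ∈ Icc 0 t, f s = r ∧ ∀ u ∈ Icc 0 s, f u ≤ r := by
  have hne : (Icc 0 t ∩ f ⁻¹' {r}).Nonempty := by
    obtain ⟨u, hu, hfu⟩ := intermediate_value_Icc ht hf.continuousOn ⟨h0, h1⟩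
    exact ⟨u, hu, hfu⟩
  obtain ⟨s, ⟨hs, hfs⟩, hmin⟩ :=
    (isCompact_Icc.inter_right (isClosed_singleton.preimage hf)).exists_isLeast hne
  refine ⟨s, hs, hfs, fun u hu => ?_⟩
  by_contra! hlt
  obtain ⟨w, hw, hfw⟩ := intermediate_value_Icc hu.1 hf.continuousOn ⟨h0, hlt.le⟩
  have := hmin ⟨⟨hw.1, hw.2.trans (hu.2.trans hs.2)⟩, hfw⟩
  obtain rfl : w = u := le_antisymm hw.2 (hu.2.trans this)
  exact hlt.ne' hfw

/-! ### Quantitative decrease of a Lyapunov function -/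

/-- `g` is a Lyapunov function of `v`, strictly decreasing off the finite set `A`. -/
structure IsLyapunov (v : Flow ℝ X) (A : Finset X) (g : X → ℝ) : Prop where
  continuous : Continuous g
  anti : ∀ x, Antitone fun t : ℝ => g (v t x)
  strict : ∀ x ∉ A, StrictAnti fun t : ℝ => g (v t x)

theorem IsLyapunov.le {v : Flow ℝ X} {A : Finset X} {g : X → ℝ} (h : IsLyapunov v A g) (x : X)
    {t : ℝ} (ht : 0 ≤ t) : g (v t x) ≤ g x := by
  simpa using h.anti x ht

theorem IsGradientLike.exists_isLyapunov {v : Flow ℝ X} {A : Finset X}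
    (hA : ∀ p, IsRestPoint v p → p ∈ A) (h : IsGradientLike v) : ∃ g, IsLyapunov v A g := by
  obtain ⟨g, hg, hs⟩ := h
  refine ⟨g, hg, fun x => ?_, fun x hx => hs x fun hr => hx (hA x hr)⟩
  by_cases hx : IsRestPoint v x
  · intro s t _
    simp only [hx s, hx t, le_refl]
  · exact (hs x hx).antitone

/-- The decrease over time `δ` is continuous and positive on the compact set of points at distance
at least `κ` from `A`; `c` is its minimum. -/
theorem IsLyapunov.exists_drop [CompactSpace X] {v : Flow ℝ X} {A : Finset X} {g : X → ℝ}
    (h : IsLyapunov v A g) {κ δ : ℝ} (hκ : 0 < κ) (hδ : 0 < δ) :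
    ∃ c > 0, ∀ x, (∀ p ∈ A, κ ≤ dist x p) → c ≤ g x - g (v δ x) := by
  set K : Set X := ⋂ p ∈ A, {x | κ ≤ dist x p}
  have hmem : ∀ x, x ∈ K ↔ ∀ p ∈ A, κ ≤ dist x p := by simp [K]
  have hK : IsClosed K := isClosed_biInter fun p _ =>
    isClosed_le continuous_const (continuous_id.dist continuous_const)
  rcases K.eq_empty_or_nonempty with hE | hne
  · refine ⟨1, one_pos, fun x hx => ?_⟩
    have := (hmem x).2 hx
    simp [hE] at this
  · obtain ⟨x₀, hx₀, hmin⟩ := hK.isCompact.exists_isMinOn hne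
      (f := fun x => g x - g (v δ x)) (h.continuous.sub
        (h.continuous.comp (v.continuous continuous_const continuous_id))).continuousOn
    refine ⟨g x₀ - g (v δ x₀), ?_, fun x hx => hmin ((hmem x).2 hx)⟩
    have hx₀A : x₀ ∉ A := fun hA => by
      have := (hmem x₀).1 hx₀ x₀ hA
      rw [dist_self] at this; linarith
    have := h.strict x₀ hx₀A hδ
    simp only [v.map_zero_apply] at this
    linarith

theorem exists_osc_bound [CompactSpace X] {g : X → ℝ} (hg : Continuous g) :
    ∃ D, ∀ x y, g x - g y ≤ D := by
  obtain ⟨M, hM⟩ := isCompact_univ.exists_bound_of_continuousOn hg.continuousOn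
  refine ⟨2 * M, fun x y => ?_⟩
  have h1 := abs_le.1 (hM x (mem_univ x))
  have h2 := abs_le.1 (hM y (mem_univ y))
  linarith

/-- Every sufficiently long orbit arc passes close to a point of `A`. -/
theorem IsLyapunov.exists_passage_time [CompactSpace X] {v : Flow ℝ X} {A : Finset X} {g : X → ℝ}
    (h : IsLyapunov v A g) {κ : ℝ} (hκ : 0 < κ) :
    ∃ T > 0, ∀ x, ∃ τ ∈ Icc 0 T, ∃ p ∈ A, dist (v τ x) p < κ := by
  obtain ⟨c, hc, hdrop⟩ := h.exists_drop hκ one_pos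
  obtain ⟨D, hD⟩ := exists_osc_bound h.continuous
  obtain ⟨n, hn⟩ := exists_nat_gt (D / c)
  rw [div_lt_iff₀ hc] at hn
  refine ⟨n + 1, by positivity, fun x => ?_⟩
  by_contra! hcon
  -- An orbit avoiding the `κ`-balls loses `c` per unit of time, and `n` such losses exceed the
  -- oscillation `D`.
  have key : ∀ k ≤ n, (k : ℝ) * c ≤ g x - g (v k x) := by
    intro k
    induction k with
    | zero => simp
    | succ k ih =>
      intro hk
      have h1 := ih (by omega)
      have hk' : (k : ℝ) ≤ n := by exact_mod_cast (Nat.le_of_succ_le hk)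
      have h2 := hdrop (v k x) fun p hp => hcon k ⟨by positivity, by linarith⟩ p hp
      rw [← v.map_add, add_comm] at h2
      push_cast
      linarith
  linarith [key n le_rfl, hD x (v n x)]

/-- Leaving a ball about a point of `A` costs a definite amount of `g`. -/
theorem IsLyapunov.exists_annulus_drop [CompactSpace X] {v : Flow ℝ X} {A : Finset X} {g : X → ℝ}
    (h : IsLyapunov v A g) {r : ℝ} (hsep : ∀ p ∈ A, ∀ q ∈ A, p ≠ q → 2 * r < dist p q)
    {a b : ℝ} (ha : 0 < a) (hab : a < b) (hbr : b ≤ r) :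
    ∃ c > 0, ∀ p ∈ A, ∀ x t, 0 ≤ t → dist x p ≤ a → b ≤ dist (v t x) p →
      c ≤ g x - g (v t x) := by
  -- In time `δ` no point moves by `b - a`, so crossing the annulus takes longer than `δ`. At the
  -- inner sphere the orbit is at distance at least `a` from all of `A`, and the drop there applies.
  obtain ⟨δ, hδ, hv⟩ := exists_uniform_flow_near v (sub_pos.2 hab)
  obtain ⟨c, hc, hdrop⟩ := h.exists_drop ha hδ
  refine ⟨c, hc, fun p hp x t ht hx hxt => ?_⟩
  obtain ⟨s, hs, hsa, -⟩ := exists_first_hit (f := fun u => dist (v u x) p)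
    ((orbit_continuous v x).dist continuous_const) ht (by simpa using hx) (hab.le.trans hxt)
  have hst : s + δ ≤ t := by
    by_contra! hlt
    have h1 := hv (t - s) (by linarith [hs.2]) (by linarith) (v s x)
    rw [← v.map_add, sub_add_cancel] at h1
    linarith [dist_triangle (v t x) (v s x) p]
  have h1 := hdrop (v s x) fun q hq => by
    by_cases hpq : p = q
    · rw [← hpq]; exact hsa.ge
    · have := dist_triangle_left p q (v s x)
      linarith [hsep p hp q hq hpq]
  rw [← v.map_add] at h1
  have h2 := h.anti x (show s + δ ≤ t from hst)
  have h3 := h.le x hs.1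
  rw [add_comm] at h2
  dsimp only at h2
  linarith

/-! ### Bounded integrals along orbit arcs -/

/-- In the presence of a Lyapunov function the integrals along orbit arcs are bounded. -/
theorem IsLyapunov.exists_orbitIntegral_bound [CompactSpace X] {v : Flow ℝ X} {A : Finset X}
    {g : X → ℝ} (h : IsLyapunov v A g) {α : X → X → ℝ} (hα : IsContinuousCocycle α)
    {β : X → X → ℝ} {r ε L : ℝ} (hP : HasBallPrimitives α A β r ε L) :
    ∃ K, 0 ≤ K ∧ ∀ x t, 0 ≤ t → |orbitIntegral v α x 0 t| ≤ K := by
  obtain ⟨δ, hδ, B, hB, -, hshort⟩ := exists_short_orbitIntegral_bound v hα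
  obtain ⟨c, hc, hdrop⟩ := h.exists_drop hP.r_pos hδ
  have hL := hP.L_nonneg
  have hball : ∀ p ∈ A, ∀ x t, 0 ≤ t → (∀ u ∈ Icc 0 t, v u x ∈ Metric.closedBall p r) →
      |orbitIntegral v α x 0 t| ≤ 2 * L := by
    intro p hp x t ht hx
    rw [hP.orbitIntegral_eq hp ht hx]
    have h1 := abs_le.1 (hP.bound p hp _ (hx t ⟨ht, le_rfl⟩))
    have h2 := abs_le.1 (hP.bound p hp x (by simpa using hx 0 ⟨le_rfl, ht⟩))
    exact abs_le.2 ⟨by linarith, by linarith⟩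
  have hexit : ∀ x t, 0 ≤ t → |orbitIntegral v α x 0 t| ≤ 2 * L ∨
      ∃ s ∈ Icc 0 t, |orbitIntegral v α x 0 s| ≤ 2 * L ∧ ∀ p ∈ A, r ≤ dist (v s x) p := by
    intro x t ht
    by_cases hx : ∀ p ∈ A, r ≤ dist x p
    · exact Or.inr ⟨0, ⟨le_rfl, ht⟩, (by
        have : orbitIntegral v α x 0 0 = 0 := by
          have := orbitIntegral_split (v := v) hα x le_rfl (le_refl (0 : ℝ))
          simpa using this
        rw [this, abs_zero]; linarith), by simpa using hx⟩
    · push Not at hx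
      obtain ⟨p, hp, hxp⟩ := hx
      have hcont : Continuous fun u => dist (v u x) p :=
        (orbit_continuous v x).dist continuous_const
      by_cases hin : ∀ u ∈ Icc 0 t, v u x ∈ Metric.closedBall p r
      · exact Or.inl (hball p hp x t ht hin)
      · push Not at hin
        obtain ⟨w, hw, hwr⟩ := hin
        rw [Metric.mem_closedBall, not_le] at hwr
        obtain ⟨s, hs, hsr, hle⟩ := exists_first_hit hcont hw.1 (by simpa using hxp.le) hwr.le
        refine Or.inr ⟨s, ⟨hs.1, hs.2.trans hw.2⟩, hball p hp x s hs.1 hle, fun q hq => ?_⟩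
        by_cases hpq : p = q
        · rw [← hpq]; exact hsr.ge
        · have := dist_triangle_left p q (v s x)
          linarith [hP.sep p hp q hq hpq]
  -- Each round consists of a stretch inside one ball (at most `2 * L`) and an arc of time `δ`
  -- started outside the open balls (at most `B`), which uses up `c` of the available drop of `g`.
  have key : ∀ n : ℕ, ∀ x t, 0 ≤ t → g x - g (v t x) < n * c →
      |orbitIntegral v α x 0 t| ≤ n * (2 * L + B) := by
    intro n
    induction n with
    | zero =>
      intro x t ht hx
      have := h.le x ht
      simp at hx; linarith
    | succ n ih =>
      intro x t ht hx
      push_cast at hx ⊢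
      have hn : 0 ≤ (n : ℝ) * (2 * L + B) := by positivity
      rcases hexit x t ht with h1 | ⟨s, hs, h1, hout⟩
      · linarith
      rw [orbitIntegral_split hα x hs.1 hs.2]
      rcases le_or_gt (t - s) δ with hle | hgt
      · have h2 := hshort (v s x) (t - s) (by linarith [hs.2]) hle
        exact (abs_add_le _ _).trans (by linarith)
      · rw [orbitIntegral_split hα (v s x) hδ.le hgt.le]
        have h2 := hshort (v s x) δ hδ.le le_rfl
        have h3 := hdrop _ hout
        have h4 := h.le x hs.1
        have h5 := ih (v δ (v s x)) (t - s - δ) (by linarith) (by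
          have : v (t - s - δ) (v δ (v s x)) = v t x := by
            rw [← v.map_add, ← v.map_add]; congr 1; ring
          rw [this]; linarith)
        have h6 := abs_add_le (orbitIntegral v α x 0 s) (orbitIntegral v α (v s x) 0 δ +
          orbitIntegral v α (v δ (v s x)) 0 (t - s - δ))
        have h7 := abs_add_le (orbitIntegral v α (v s x) 0 δ)
          (orbitIntegral v α (v δ (v s x)) 0 (t - s - δ))
        linarith
  obtain ⟨D, hD⟩ := exists_osc_bound h.continuous
  obtain ⟨n, hn⟩ := exists_nat_gt (D / c)
  rw [div_lt_iff₀ hc] at hn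
  exact ⟨n * (2 * L + B), by positivity, fun x t ht => key n x t ht ((hD _ _).trans_lt hn)⟩

/-! ### Integrals along chains -/

/-- A piece of a chain that passes close to `p ∈ A`, makes one small jump, and passes close to
`q ∈ A` with `g p ≤ g q`, stays in the ball about `p = q`. -/
theorem IsLyapunov.exists_level_passage [CompactSpace X] {v : Flow ℝ X} {A : Finset X}
    {g : X → ℝ} (h : IsLyapunov v A g) {α : X → X → ℝ} {β : X → X → ℝ} {r ε L : ℝ}
    (hP : HasBallPrimitives α A β r ε L) :
    ∃ κ, 0 < κ ∧ κ ≤ r ∧ ∀ p ∈ A, ∀ q ∈ A, g p ≤ g q → ∀ y z σ τ, 0 ≤ σ → 0 ≤ τ →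
      dist y p < κ → dist (v σ y) z < κ → dist (v τ z) q < κ →
      p = q ∧ orbitIntegral v α y 0 σ + α (v σ y) z + orbitIntegral v α z 0 τ =
        β p (v τ z) - β p y := by
  have hr := hP.r_pos
  -- Two annuli, one for each arc: the first arc stays within `r / 2`, the jump of size at most `r /
  -- 4` leads to within `3 * r / 4`, and the second arc stays within `r`.
  obtain ⟨c₁, hc₁, hd₁⟩ := h.exists_annulus_drop hP.sep (a := r / 4) (b := r / 2)
    (by linarith) (by linarith) (by linarith)
  obtain ⟨c₂, hc₂, hd₂⟩ := h.exists_annulus_drop hP.sep (a := 3 * r / 4) (b := r)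
    (by linarith) (by linarith) le_rfl
  obtain ⟨c, hc, hcc₁, hcc₂⟩ : ∃ c > 0, c ≤ c₁ ∧ c ≤ c₂ :=
    ⟨min c₁ c₂, lt_min hc₁ hc₂, min_le_left _ _, min_le_right _ _⟩
  -- Three errors in `g` occur, near `p`, at the jump and near `q`; with `g p ≤ g q`, the total loss
  -- of `g` along the two arcs is below `c`, too little to cross an annulus.
  obtain ⟨κ₀, hκ₀, hg⟩ := Metric.uniformContinuous_iff.1
    (CompactSpace.uniformContinuous_of_continuous h.continuous) (c / 3) (by linarith)
  obtain ⟨κ, hκ, hκ1, hκ2, hκ3⟩ : ∃ κ > 0, κ ≤ κ₀ ∧ κ ≤ r / 4 ∧ κ ≤ ε :=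
    ⟨min κ₀ (min (r / 4) ε), lt_min hκ₀ (lt_min (by linarith) hP.ε_pos), by simp, by simp,
      by simp⟩
  refine ⟨κ, hκ, by linarith, fun p hp q hq hpq y z σ τ hσ hτ hy hz hw => ?_⟩
  have g1 := abs_lt.1 (hg (hy.trans_le hκ1))
  have g2 := abs_lt.1 (hg (hz.trans_le hκ1))
  have g3 := abs_lt.1 (hg (hw.trans_le hκ1))
  have in₁ : ∀ u ∈ Icc 0 σ, dist (v u y) p < r / 2 := by
    intro u hu
    by_contra! hcon
    have h1 := hd₁ p hp y u hu.1 (by linarith) hcon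
    have h2 := h.anti y hu.2
    have h3 := h.le z hτ
    dsimp only at h2
    linarith
  have hzp : dist z p ≤ 3 * r / 4 := by
    have h1 := in₁ σ ⟨hσ, le_rfl⟩
    have h2 := dist_triangle_left z p (v σ y)
    linarith
  have in₂ : ∀ u ∈ Icc 0 τ, dist (v u z) p < r := by
    intro u hu
    by_contra! hcon
    have h1 := hd₂ p hp z u hu.1 hzp hcon
    have h2 := h.anti z hu.2
    have h3 := h.le y hσ
    dsimp only at h2
    linarith
  have e : p = q := by
    by_contra hne
    have h1 := hP.sep p hp q hq hne
    have h2 := dist_triangle_left p q (v τ z)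
    linarith [in₂ τ ⟨hτ, le_rfl⟩]
  refine ⟨e, ?_⟩
  have b₁ : ∀ u ∈ Icc 0 σ, v u y ∈ Metric.closedBall p r := fun u hu =>
    Metric.mem_closedBall.2 (by linarith [in₁ u hu])
  have b₂ : ∀ u ∈ Icc 0 τ, v u z ∈ Metric.closedBall p r := fun u hu =>
    Metric.mem_closedBall.2 (in₂ u hu).le
  rw [hP.orbitIntegral_eq hp hσ b₁, hP.orbitIntegral_eq hp hτ b₂,
    hP.prim p hp _ (b₁ σ ⟨hσ, le_rfl⟩) z (Metric.mem_closedBall.2 (by linarith))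
      (hz.trans_le hκ3)]
  ring

/-- In the presence of a Lyapunov function the integrals along chains with small jumps and long
times are bounded. -/
theorem IsLyapunov.exists_chainIntegral_bound [CompactSpace X] {v : Flow ℝ X} {A : Finset X}
    {g : X → ℝ} (h : IsLyapunov v A g) {α : X → X → ℝ} (hα : IsContinuousCocycle α)
    {β : X → X → ℝ} {r ε L : ℝ} (hP : HasBallPrimitives α A β r ε L) :
    ∃ κ > 0, ∃ T > 0, ∃ M, ∀ (n : ℕ) (x : Fin (n + 1 + 1) → X) (t : Fin (n + 1) → ℝ),
      (∀ i, T ≤ t i ∧ dist (v (t i) (x i.castSucc)) (x i.succ) < κ) →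
      |chainIntegral v α x t| ≤ M := by
  classical
  obtain ⟨K, hK, hKb⟩ := h.exists_orbitIntegral_bound hα hP
  obtain ⟨B, hB⟩ := hα.bounded
  obtain ⟨κ, hκ, hκr, hlev⟩ := h.exists_level_passage hP
  obtain ⟨T, hT, hpass⟩ := h.exists_passage_time hκ
  have hL := hP.L_nonneg
  -- The rank of the level of `p`: it bounds how often passages can still move to a lower level.
  let m : X → ℕ := fun p => (A.filter fun q => g q < g p).card
  have hm : ∀ p, ∀ q ∈ A, g q < g p → m q + 1 ≤ m p := fun p q hq hlt => by
    refine Finset.card_lt_card ⟨fun w hw => ?_, fun hsub => ?_⟩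
    · simp only [Finset.mem_filter] at hw ⊢
      exact ⟨hw.1, hw.2.trans hlt⟩
    · have : q ∈ A.filter fun w => g w < g q := hsub (Finset.mem_filter.2 ⟨hq, hlt⟩)
      simp at this
  have hmA : ∀ p, (m p : ℝ) ≤ A.card := fun p => by exact_mod_cast Finset.card_filter_le _ _
  -- The quantity estimated is the integral from the passage near `p` onwards, corrected by `β p`
  -- there. A step on which the primitive computes the integral leaves it unchanged, so only drops
  -- in rank enter the bound.
  have key : ∀ (n : ℕ) (x : Fin (n + 1 + 1) → X) (t : Fin (n + 1) → ℝ),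
      (∀ i, T ≤ t i ∧ dist (v (t i) (x i.castSucc)) (x i.succ) < κ) →
      ∀ τ ∈ Icc 0 T, ∀ p ∈ A, dist (v τ (x 0)) p < κ →
      |chainIntegral v α x t - orbitIntegral v α (x 0) 0 τ + β p (v τ (x 0))| ≤
        m p * (2 * K + B + 2 * L) + L + K + B := by
    intro n
    induction n with
    | zero =>
      intro x t hx τ hτ p hp hd
      have hB0 : 0 ≤ B := (abs_nonneg _).trans (hB (x 0) (x 0))
      have hτt : τ ≤ t 0 := hτ.2.trans (hx 0).1
      have h1 := abs_le.1 (hKb (v τ (x 0)) (t 0 - τ) (by linarith))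
      have h2 := abs_le.1 (hB (v (t 0) (x 0)) (x 1))
      have h3 := abs_le.1 (hP.bound p hp (v τ (x 0)) (Metric.mem_closedBall.2 (by linarith)))
      have h4 : chainIntegral v α x t = orbitIntegral v α (x 0) 0 τ +
          orbitIntegral v α (v τ (x 0)) 0 (t 0 - τ) + α (v (t 0) (x 0)) (x 1) := by
        rw [← orbitIntegral_split hα (x 0) hτ.1 hτt]
        simp [chainIntegral]
      have h5 : 0 ≤ (m p : ℝ) * (2 * K + B + 2 * L) := by positivity
      rw [h4]
      exact abs_le.2 ⟨by linarith, by linarith⟩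
    | succ n ih =>
      intro x t hx τ hτ p hp hd
      have hB0 : 0 ≤ B := (abs_nonneg _).trans (hB (x 0) (x 0))
      have hτt : τ ≤ t 0 := hτ.2.trans (hx 0).1
      obtain ⟨τ', hτ', q, hq, hdq⟩ := hpass (x 1)
      have h1 := ih (fun i => x i.succ) (fun i => t i.succ) (fun i => hx i.succ) τ' hτ' q hq hdq
      have h4 : chainIntegral v α x t = orbitIntegral v α (x 0) 0 τ +
          orbitIntegral v α (v τ (x 0)) 0 (t 0 - τ) + α (v (t 0) (x 0)) (x 1) +
          chainIntegral v α (fun i => x i.succ) (fun i => t i.succ) := by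
        rw [← orbitIntegral_split hα (x 0) hτ.1 hτt, chainIntegral, Fin.sum_univ_succ]
        rfl
      rw [Fin.succ_zero_eq_one] at h1
      have hv : v (t 0 - τ) (v τ (x 0)) = v (t 0) (x 0) := by rw [← v.map_add, sub_add_cancel]
      have hjump : dist (v (t 0) (x 0)) (x 1) < κ := (hx 0).2
      rcases le_or_gt (g p) (g q) with hle | hlt
      · obtain ⟨rfl, hint⟩ := hlev p hp q hq hle (v τ (x 0)) (x 1) (t 0 - τ) τ' (by linarith)
          hτ'.1 hd (by rwa [hv]) hdq
        rw [hv] at hint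
        convert h1 using 2
        rw [h4]
        linarith
      -- The rank drops, which pays for two arcs (`2 * K`), one jump (`B`) and two values of
      -- primitives (`2 * L`).
      · have k1 := abs_le.1 (hKb (v τ (x 0)) (t 0 - τ) (by linarith))
        have k2 := abs_le.1 (hB (v (t 0) (x 0)) (x 1))
        have k3 := abs_le.1 (hP.bound p hp (v τ (x 0)) (Metric.mem_closedBall.2 (by linarith)))
        have k4 := abs_le.1 (hP.bound q hq (v τ' (x 1)) (Metric.mem_closedBall.2 (by linarith)))
        have k5 := abs_le.1 (hKb (x 1) τ' hτ'.1)
        have k6 : ((m q : ℝ) + 1) * (2 * K + B + 2 * L) ≤ m p * (2 * K + B + 2 * L) := by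
          have : (m q : ℝ) + 1 ≤ m p := by exact_mod_cast hm p q hq hlt
          gcongr
        have k7 := abs_le.1 h1
        rw [h4]
        exact abs_le.2 ⟨by linarith, by linarith⟩
  refine ⟨κ, hκ, T, hT, A.card * (2 * K + B + 2 * L) + L + K + B + K + L,
    fun n x t hx => ?_⟩
  obtain ⟨τ, hτ, p, hp, hd⟩ := hpass (x 0)
  have hB0 : 0 ≤ B := (abs_nonneg _).trans (hB (x 0) (x 0))
  have h1 := abs_le.1 (key n x t hx τ hτ p hp hd)
  have h2 := abs_le.1 (hKb (x 0) τ hτ.1)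
  have h3 := abs_le.1 (hP.bound p hp (v τ (x 0)) (Metric.mem_closedBall.2 (by linarith)))
  have h4 : (m p : ℝ) * (2 * K + B + 2 * L) ≤ A.card * (2 * K + B + 2 * L) := by
    have := hmA p
    gcongr
  exact abs_le.2 ⟨by linarith, by linarith⟩

/-! ### Cycles of orbits -/

theorem orbitIntegral_of_isRestPoint [CompactSpace X] {v : Flow ℝ X} {α : X → X → ℝ}
    (hα : IsContinuousCocycle α) {x : X} (hx : IsRestPoint v x) {a b : ℝ} (hab : a ≤ b) :
    orbitIntegral v α x a b = 0 := by
  have hd : α x x = 0 := by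
    have := (hα.cocycle x).self_of_nhds
    simpa using this
  have := HasCocycleIntegral.eq hab (hasCocycleIntegral_of_primitive (α := α)
    (γ := fun u => v u x) (F := fun _ => 0) one_pos fun s _ u _ _ _ => by simp [hx s, hx u, hd])
  simpa [orbitIntegral] using this

/-- In a gradient-like flow, every orbit of a cycle of orbits is constant. -/
theorem IsGradientLike.isRestPoint_of_isOrbitCycle {v : Flow ℝ X} (h : IsGradientLike v) {k : ℕ}
    {p : Fin (k + 1) → X} {x : Fin k → X} (hc : IsOrbitCycle v p x) (j : Fin k) :
    IsRestPoint v (x j) := by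
  obtain ⟨g, hg, hs⟩ := h
  obtain ⟨-, hlast, -, hlim⟩ := hc
  have hanti : ∀ y, Antitone fun t : ℝ => g (v t y) := fun y => by
    by_cases hy : IsRestPoint v y
    · intro s t _
      simp only [hy s, hy t, le_refl]
    · exact (hs y hy).antitone
  have hle : ∀ i t, g (p i.succ) ≤ g (v t (x i)) ∧ g (v t (x i)) ≤ g (p i.castSucc) := fun i t =>
    ⟨(hanti (x i)).le_of_tendsto ((hg.tendsto _).comp (hlim i).2) t,
      (hanti (x i)).ge_of_tendsto ((hg.tendsto _).comp (hlim i).1) t⟩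
  -- Since the last fixed point is the first, this monotonicity forces all `g (p i)` to agree, and
  -- no orbit between them can lower `g`.
  have hp : Antitone fun i => g (p i) :=
    Fin.antitone_iff_succ_le.2 fun i => (hle i 0).1.trans (hle i 0).2
  by_contra hx
  have h1 := hs _ hx (zero_lt_one' ℝ)
  have h2 := hp (Fin.zero_le j.castSucc)
  have h3 := hp (Fin.le_last j.succ)
  have h4 := (hle j 0).2
  have h5 := (hle j 1).1
  simp only [hlast] at h1 h2 h3
  linarith

end Flow

/-! ### The three criteria -/

theorem theorem3p3 {X : Type*} [MetricSpace X] [CompactSpace X] (v : Flow ℝ X)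
    (α : X → X → ℝ) (hv : IsAlphaFlow v α) (hα : ¬ IsTrivialCocycle α) :
    (∀ (s : ℕ → ℝ) (C : ℕ → Set X), (∀ i, 0 < s i) → Tendsto s atTop (𝓝 0) →
      (∀ i, IsBallCovering (C i) (s i)) →
      (∀ M : ℝ, 0 < M → ∀ T : ℝ, 0 < T → ∀ i : ℕ,
        ∃ (n : ℕ) (x : Fin (n + 1) → X) (t : Fin n → ℝ),
          IsFlowChain v (C i) (s i) T x t ∧ M ≤ |chainIntegral v α x t|) →
      ¬ IsGradientLike v) ∧
    ((∀ M : ℝ, 0 < M → ∃ (x : X) (t : ℝ), 0 ≤ t ∧ M ≤ |orbitIntegral v α x 0 t|) →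
      ¬ IsGradientLike v) ∧
    ((∃ (k : ℕ) (p : Fin (k + 1) → X) (x : Fin k → X) (I : Fin k → ℝ),
        IsOrbitCycle v p x ∧ (∀ j, HasFullOrbitIntegral v α (x j) (I j)) ∧ 1 ≤ |∑ j, I j|) →
      ¬ IsGradientLike v) := by
  obtain ⟨hc, A, V, r, T₀, ρ, lam, hdata⟩ := hv
  obtain ⟨β, r', ε, L, hP⟩ := hdata.exists_hasBallPrimitives
  refine ⟨fun s C hs hs0 _ hch hgrad => ?_, fun hb hgrad => ?_, ?_⟩
  · obtain ⟨g, hg⟩ := hgrad.exists_isLyapunov hdata.rest_mem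
    obtain ⟨κ, hκ, T, hT, M, hM⟩ := hg.exists_chainIntegral_bound hc hP
    -- Two points in a common ball of radius less than `κ / 2` are less than `κ` apart.
    obtain ⟨i, hi⟩ := (hs0.eventually_lt_const (half_pos hκ)).exists
    obtain ⟨n, x, t, ⟨hn, hx⟩, hlarge⟩ := hch (|M| + 1) (by positivity) T hT i
    obtain ⟨n, rfl⟩ := Nat.exists_eq_succ_of_ne_zero hn.ne'
    have := hM n x t fun j => ⟨(hx j).1, by
      obtain ⟨c, -, h1, h2⟩ := (hx j).2
      have h3 := dist_triangle_right (v (t j) (x j.castSucc)) (x j.succ) c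
      rw [Metric.mem_ball] at h1 h2
      linarith⟩
    linarith [le_abs_self M]
  · obtain ⟨g, hg⟩ := hgrad.exists_isLyapunov hdata.rest_mem
    obtain ⟨K, hK, hKb⟩ := hg.exists_orbitIntegral_bound hc hP
    obtain ⟨x, t, ht, hlarge⟩ := hb (K + 1) (by linarith)
    linarith [hKb x t ht]
  · rintro ⟨k, p, x, I, hcyc, hI, hsum⟩ hgrad
    -- The orbit is a rest point, so the limit is that of the constant `0`.
    have hI0 : ∀ j, I j = 0 := fun j => by
      refine tendsto_nhds_unique (hI j) (tendsto_const_nhds.congr' ?_)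
      have : ∀ᶠ q : ℝ × ℝ in atBot ×ˢ atTop, q.1 ≤ 0 ∧ 0 ≤ q.2 :=
        (eventually_le_atBot 0).prod_mk (eventually_ge_atTop 0)
      filter_upwards [this] with q hq
      exact (orbitIntegral_of_isRestPoint hc (hgrad.isRestPoint_of_isOrbitCycle hcyc j)
        (hq.1.trans hq.2)).symm
    simp [hI0] at hsum
    linarith
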